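/- Let $d \geq 0$ and let $C \subseteq \mathbb{R}^d$ be a convex cone (a non-empty subset closed under addition and under multiplication by scalars $\geq 0$) that is closed, proper ($C \cap -C = \{0\}$) and generating ($C - C = \mathbb{R}^d$). Assume that at least one of the following holds: $d \leq 4$; $C$ is strictly convex (every non-zero boundary point $x$ of $C$ is an extremal direction, i.e. $y \in C$ and $x - y \in C$ imply that $y$ is a multiple of $x$); $C$ is smooth (every non-zero boundary point of $C$ has exactly one supporting hyperplane); $C$ is polyhedral (an intersection of finitely many closed half-spaces $\{\varphi \geq 0\}$ with $\varphi$ a linear functional). For $n \geq 1$ let $\mathrm{Her}_n$ be the real vector space of complex hermitian $n \times n$ matrices and $\mathrm{Her}_n^+$ its cone of positive semidefinite matrices. Let $C_n^{\min} \subseteq \mathrm{Her}_n \otimes_{\mathbb{R}} \mathbb{R}^d$ be the projective cone, consisting of all finite sums $\sum_i A_i \otimes x_i$ with $A_i \in \mathrm{Her}_n^+$, $x_i \in C$, and let $C_n^{\max}$ be the injective cone, consisting of all $u \in \mathrm{Her}_n \otimes_{\mathbb{R}} \mathbb{R}^d$ such that $\langle u, \varphi \otimes \psi\rangle \geq 0$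 for all linear functionals $\varphi$ on $\mathrm{Her}_n$ that are non-negative on $\mathrm{Her}_n^+$ and all linear functionals $\psi$ on $\mathbb{R}^d$ that are non-negative on $C$. The minimal and maximal operator systems of $C$ are the families $C^{\min} = \{C_n^{\min}\}_{n=1}^\infty$ and $C^{\max} = \{C_n^{\max}\}_{n=1}^\infty$. Then the following are equivalent: (i) $C$ is a simplex cone, i.e. $C$ is generated by a basis of $\mathbb{R}^d$; (ii) the minimal and maximal operator systems coincide: $C^{\min} = C^{\max}$; (iii) there exists $n \geq 2$ for which $C_n^{\min} = C_n^{\max}$; (iv) $C_2^{\min} = C_2^{\max}$. -/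

import Mathlib

open Module TensorProduct
open scoped ComplexOrder

noncomputable section

/- Convex cones in a real vector space `E` (non-empty, closed under addition and under
multiplication by scalars `≥ 0`) are Mathlib's `PointedCone ℝ E`. -/

section ConvexCones

variable {E : Type*} [AddCommGroup E] [Module ℝ E]

/-- A simplex cone (Yudin cone): a cone generated by a basis of the whole space. -/
def IsSimplexCone (C : PointedCone ℝ E) : Prop :=
  ∃ b : Basis (Fin (finrank ℝ E)) ℝ E, C = PointedCone.hull ℝ (Set.range b)

/-- `x` is an extremal direction of `C`: it is a non-zero element of `C` such that `0 ≤ y ≤ x`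
in the order defined by `C` is possible only for multiples `y` of `x`. -/
def IsExtremalDirection (C : PointedCone ℝ E) (x : E) : Prop :=
  x ∈ C ∧ x ≠ 0 ∧ ∀ y ∈ C, x - y ∈ C → ∃ c : ℝ, y = c • x

/-- `H` is a supporting hyperplane of `C` at `x`: the kernel of a non-zero linear functional that
is non-negative on `C` and vanishes at `x`. (A hyperplane supporting a cone at one of its points
always passes through the origin.) -/
def IsSupportingHyperplane (C : PointedCone ℝ E) (x : E) (H : Submodule ℝ E) : Prop :=
  ∃ φ : Dual ℝ E, φ ≠ 0 ∧ (∀ y ∈ C, 0 ≤ φ y) ∧ φ x = 0 ∧ H = LinearMap.ker φ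

/-- A strictly convex cone: every non-zero boundary point is an extremal direction. -/
def IsStrictlyConvexCone [TopologicalSpace E] (C : PointedCone ℝ E) : Prop :=
  ∀ x ∈ frontier (C : Set E), x ≠ 0 → IsExtremalDirection C x

/-- A smooth cone: every non-zero boundary point has exactly one supporting hyperplane. -/
def IsSmoothCone [TopologicalSpace E] (C : PointedCone ℝ E) : Prop :=
  ∀ x ∈ frontier (C : Set E), x ≠ 0 → ∃! H : Submodule ℝ E, IsSupportingHyperplane C x H

/-- A polyhedral cone: an intersection of finitely many closed half-spaces `{x | 0 ≤ φ x}`. -/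
def IsPolyhedralCone (C : PointedCone ℝ E) : Prop :=
  ∃ s : Finset (Dual ℝ E), ∀ x : E, x ∈ C ↔ ∀ φ ∈ s, 0 ≤ φ x

end ConvexCones

section OperatorSystems

/-- The real vector space of complex hermitian `n × n` matrices. -/
abbrev Herm (n : ℕ) : Type := selfAdjoint (Matrix (Fin n) (Fin n) ℂ)

/-- The cone of positive semidefinite matrices in the space of hermitian matrices. -/
def hermPos (n : ℕ) : PointedCone ℝ (Herm n) where
  carrier := {A | (A : Matrix (Fin n) (Fin n) ℂ).PosSemidef}
  add_mem' := fun hA hB => hA.add hB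
  zero_mem' := Matrix.PosSemidef.zero
  smul_mem' := fun c A hA => by
    have h : (A : Matrix (Fin n) (Fin n) ℂ).PosSemidef := hA
    exact h.smul c.2

variable {E : Type*} [AddCommGroup E] [Module ℝ E]

/-- Level `n` of the minimal operator system of `C`: the projective cone of the positive
semidefinite cone and `C`, that is, all finite sums of `A ⊗ₜ x` with `A` positive semidefinite
and `x ∈ C`. -/
def minOpSysLevel (n : ℕ) (C : PointedCone ℝ E) : PointedCone ℝ (Herm n ⊗[ℝ] E) :=
  PointedCone.minTensorProduct (hermPos n) C

/-- Level `n` of the maximal operator system of `C`: the injective cone of the positive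
semidefinite cone and `C`, that is, all tensors on which `φ ⊗ ψ` is non-negative for all
`φ`, `ψ` in the respective dual cones. -/
def maxOpSysLevel (n : ℕ) (C : PointedCone ℝ E) : PointedCone ℝ (Herm n ⊗[ℝ] E) :=
  PointedCone.maxTensorProduct (hermPos n) C

/-- The minimal operator system of `C`: the family of its levels `n = 1, 2, 3, …`. -/
def minOpSys (C : PointedCone ℝ E) (n : ℕ+) : PointedCone ℝ (Herm n ⊗[ℝ] E) :=
  minOpSysLevel n C

/-- The maximal operator system of `C`: the family of its levels `n = 1, 2, 3, …`. -/
def maxOpSys (C : PointedCone ℝ E) (n : ℕ+) : PointedCone ℝ (Herm n ⊗[ℝ] E) :=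
  maxOpSysLevel n C

end OperatorSystems

end

/-! The substance is that equality at a single level n ≥ 2 forces a simplex cone; the converse
follows by expanding tensors in the generating basis.

Let w₁, w₂ lie in exposed faces C ∩ ker f₁, C ∩ ker f₂ meeting only in 0. If g² ≤ F₁F₂ on C with F₁,
F₂ ≥ 0 there, the block functional with diagonal F₁, F₂ and off-diagonal -g is non-negative on the
minimal cone. Equality of the levels makes it non-negative on maximal tensors too, in particular on
2 × 2 blocks built from w₁, w₂ and an element z with w₁ + w₂ ± z ∈ C. If g vanishes on the second
face and at w₁ and is non-negative on the first face, F₁ and F₂ can be chosen with F₁ w₁ + F₂ w₂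
arbitrarily small, while the other factor of the resulting bound stays under control. Hence g
vanishes on the whole order interval below w₁ + w₂ (`eq_zero_of_minOpSysLevel_eq_max`).

Simpliciality follows by induction on the dimension of the span. Equality of levels passes to
exposed faces, so an exposed face F of maximal dimension is spanned by an independent set t. Add an
exposed ray y outside F. By the vanishing criterion, sums of y and elements of t lie in proper
exposed faces whenever a suitable g exists. Maximality of F then gives C ⊆ span(t ∪ {y}), and the
functionals exposing these faces show that coordinates in t ∪ {y} are non-negative on C. -/

noncomputable section

/-! ### Exposed rays and faces of closed cones. -/

section ConeGeometry

variable {E : Type*} [NormedAddCommGroup E] [NormedSpace ℝ E] [FiniteDimensional ℝ E]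

omit [FiniteDimensional ℝ E] in
theorem exists_dual_pos_of_mem {C : PointedCone ℝ E} (hC : IsClosed (C : Set E))
    (hs : (C : ConvexCone ℝ E).Salient) {x : E} (hx : x ∈ C) (hx0 : x ≠ 0) :
    ∃ f : Dual ℝ E, (∀ z ∈ C, 0 ≤ f z) ∧ 0 < f x := by
  have hn : -x ∉ C := hs x hx hx0
  obtain ⟨f, hf, hfx⟩ := ProperCone.hyperplane_separation_point (⟨C, hC⟩ : ProperCone ℝ E) hn
  refine ⟨f, fun z hz => hf z hz, ?_⟩
  have : f (-x) < 0 := hfx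
  rw [map_neg] at this
  exact neg_lt_zero.1 this

/-- A closed salient cone admits a strictly positive functional. -/
theorem exists_dual_strictly_pos {C : PointedCone ℝ E} (hC : IsClosed (C : Set E))
    (hs : (C : ConvexCone ℝ E).Salient) :
    ∃ h : Dual ℝ E, ∀ x ∈ C, x ≠ 0 → 0 < h x := by
  have hcomp : IsCompact ((C : Set E) ∩ Metric.sphere 0 1) :=
    (isCompact_sphere 0 1).inter_left hC
  obtain ⟨h, h0, hh⟩ : ∃ h : Dual ℝ E, (∀ z ∈ C, 0 ≤ h z) ∧
      ∀ x ∈ (C : Set E) ∩ Metric.sphere 0 1, 0 < h x := by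
    suffices H : ∃ h : Dual ℝ E, (∀ z ∈ C, 0 ≤ h z) ∧
        ∀ x ∈ (C : Set E) ∩ Metric.sphere 0 1, x ∈ C → 0 < h x by
      obtain ⟨h, h0, hh⟩ := H
      exact ⟨h, h0, fun x hx => hh x hx hx.1⟩
    -- Each point has a functional positive near it; a sum of finitely many is positive on the
    -- compact slice.
    refine hcomp.induction_on (p := fun s => ∃ h : Dual ℝ E, (∀ z ∈ C, 0 ≤ h z) ∧
      ∀ x ∈ s, x ∈ C → 0 < h x) ⟨0, by simp, by simp⟩ ?_ ?_ ?_
    · rintro s t hst ⟨h, h0, hh⟩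
      exact ⟨h, h0, fun x hx => hh x (hst hx)⟩
    · rintro s t ⟨h, h0, hh⟩ ⟨k, k0, hk⟩
      refine ⟨h + k, fun z hz => add_nonneg (h0 z hz) (k0 z hz), ?_⟩
      rintro x (hx | hx) hxC
      · exact add_pos_of_pos_of_nonneg (hh x hx hxC) (k0 x hxC)
      · exact add_pos_of_nonneg_of_pos (h0 x hxC) (hk x hx hxC)
    · rintro x ⟨hx, hx1⟩
      have hx0 : x ≠ 0 := by
        rintro rfl
        simp at hx1
      obtain ⟨f, hf, hfx⟩ := exists_dual_pos_of_mem hC hs hx hx0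
      refine ⟨{z | 0 < f z}, mem_nhdsWithin_of_mem_nhds ?_, f, hf, fun z hz _ => hz⟩
      exact (isOpen_lt continuous_const f.continuous_of_finiteDimensional).mem_nhds hfx
  refine ⟨h, fun x hx hx0 => ?_⟩
  have hpos : 0 < ‖x‖ := norm_pos_iff.2 hx0
  have := hh (‖x‖⁻¹ • x) ⟨C.smul_mem (inv_pos.2 hpos).le hx, by
    simp [norm_smul, hpos.ne']⟩
  rw [map_smul, smul_eq_mul] at this
  exact (mul_pos_iff_of_pos_left (inv_pos.2 hpos)).1 this

theorem isCompact_base {C : PointedCone ℝ E} (hC : IsClosed (C : Set E))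
    {h : Dual ℝ E} (hh : ∀ x ∈ C, x ≠ 0 → 0 < h x) :
    IsCompact {x | x ∈ C ∧ h x = 1} := by
  have hcont := h.continuous_of_finiteDimensional
  have hcomp : IsCompact ((C : Set E) ∩ Metric.sphere 0 1) :=
    (isCompact_sphere 0 1).inter_left hC
  have hpos : ∀ x ∈ (C : Set E) ∩ Metric.sphere 0 1, 0 < h x := by
    rintro x ⟨hx, hx1⟩
    refine hh x hx ?_
    rintro rfl
    simp at hx1
  obtain ⟨δ, hδ, hδle⟩ := hcomp.exists_forall_le' hcont.continuousOn hpos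
  refine (isCompact_closedBall (0 : E) δ⁻¹).of_isClosed_subset
    (hC.inter (isClosed_eq hcont continuous_const)) ?_
  rintro x ⟨hx, hx1⟩
  have hx0 : x ≠ 0 := by
    rintro rfl
    simp at hx1
  have hnorm : 0 < ‖x‖ := norm_pos_iff.2 hx0
  have := hδle (‖x‖⁻¹ • x) ⟨C.smul_mem (inv_pos.2 hnorm).le hx, by
    simp [norm_smul, hnorm.ne']⟩
  rw [map_smul, smul_eq_mul, hx1, mul_one] at this
  rw [mem_closedBall_zero_iff]
  exact (le_inv_comm₀ hδ hnorm).1 this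

/-- A linear functional that is positive somewhere on a closed salient cone is positive at some
generator of an exposed ray. -/
theorem exists_exposed_ray_pos {C : PointedCone ℝ E} (hC : IsClosed (C : Set E))
    (hs : (C : ConvexCone ℝ E).Salient) (f : Dual ℝ E) {c : E} (hc : c ∈ C) (hfc : 0 < f c) :
    ∃ y ∈ C, 0 < f y ∧ ∃ k : Dual ℝ E, (∀ x ∈ C, 0 ≤ k x) ∧ k y = 0 ∧
      ∀ x ∈ C, k x = 0 → ∃ t : ℝ, x = t • y := by
  obtain ⟨h, hh⟩ := exists_dual_strictly_pos hC hs
  set K : Set E := {x | x ∈ C ∧ h x = 1} with hK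
  have hKc : IsCompact K := isCompact_base hC hh
  have normalize : ∀ x ∈ C, x ≠ 0 → (h x)⁻¹ • x ∈ K := fun x hx hx0 =>
    ⟨C.smul_mem (inv_pos.2 (hh x hx hx0)).le hx, by
      rw [map_smul, smul_eq_mul, inv_mul_cancel₀ (hh x hx hx0).ne']⟩
  have hc0 : c ≠ 0 := by
    rintro rfl
    simp at hfc
  let φ := toEuclidean (E := E)
  let fc : EuclideanSpace ℝ (Fin (finrank ℝ E)) →L[ℝ] ℝ :=
    LinearMap.toContinuousLinearMap (f ∘ₗ φ.symm.toLinearEquiv.toLinearMap)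
  let v := (InnerProductSpace.toDual ℝ _).symm fc
  have hv : ∀ x, inner ℝ v (φ x) = f x := fun x => by
    simp [v, fc]
  set c' := (h c)⁻¹ • c with hc'
  have hc'K : c' ∈ K := normalize c hc hc0
  have hfc' : 0 < f c' := by
    rw [hc', map_smul, smul_eq_mul]
    exact mul_pos (inv_pos.2 (hh c hc hc0)) hfc
  obtain ⟨M, hM⟩ := hKc.exists_bound_of_continuousOn (f := fun x => ‖φ x‖ ^ 2)
    (by fun_prop)
  obtain ⟨t, ht⟩ : ∃ t : ℝ, 0 < t ∧ M < 2 * t * f c' := by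
    refine ⟨(|M| + 1) / (2 * f c'), by positivity, ?_⟩
    have : 2 * ((|M| + 1) / (2 * f c')) * f c' = |M| + 1 := by
      field_simp
    rw [this]
    linarith [le_abs_self M]
  obtain ⟨ht0, ht⟩ := ht
  -- A point of the base farthest from -t • v is exposed. For t this large, the term 2 t f outweighs
  -- the variation of ‖φ x‖², so f is positive there.
  obtain ⟨y, hyK, hy⟩ := hKc.exists_isMaxOn ⟨c', hc'K⟩ (f := fun x => ‖φ x + t • v‖ ^ 2)
    (by fun_prop)
  have expand : ∀ x, ‖φ x + t • v‖ ^ 2 = ‖φ x‖ ^ 2 + 2 * t * f x + ‖t • v‖ ^ 2 := fun x => by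
    rw [norm_add_sq_real, inner_smul_right, real_inner_comm, hv]
    ring
  have hfy : 0 < f y := by
    have h1 := hy hc'K
    simp only [Set.mem_ofPred_eq, expand] at h1
    have h2 := hM y hyK
    rw [Real.norm_of_nonneg (by positivity)] at h2
    have h3 : 0 < 2 * t * f y := by nlinarith [sq_nonneg ‖φ c'‖]
    exact (mul_pos_iff_of_pos_left (by positivity)).1 h3
  set q := φ y + t • v with hq
  -- The tangent hyperplane at y of the sphere about -t • v, made homogeneous by means of `h`, which
  -- equals 1 on the base.
  let k : Dual ℝ E := (‖q‖ ^ 2 - t * inner ℝ q v) • h -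
    (innerSL ℝ q).toLinearMap ∘ₗ φ.toLinearEquiv.toLinearMap
  have hk : ∀ x ∈ K, k x = ‖q‖ ^ 2 - inner ℝ q (φ x + t • v) := by
    rintro x ⟨-, hx⟩
    simp only [k, LinearMap.sub_apply, LinearMap.smul_apply, hx, LinearMap.comp_apply,
      inner_add_right, inner_smul_right]
    simp
    ring
  have hk2 : ∀ x ∈ K, ‖q - (φ x + t • v)‖ ^ 2 ≤ 2 * k x := by
    intro x hx
    have h1 := hy hx
    simp only [Set.mem_ofPred_eq] at h1
    rw [hk x hx, norm_sub_sq_real]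
    linarith
  have hky : k y = 0 := by
    rw [hk y hyK, ← hq, real_inner_self_eq_norm_sq, sub_self]
  have kscale : ∀ x ∈ C, x ≠ 0 → k x = h x * k ((h x)⁻¹ • x) := fun x hx hx0 => by
    rw [map_smul, smul_eq_mul, mul_inv_cancel_left₀ (hh x hx hx0).ne']
  refine ⟨y, hyK.1, hfy, k, fun x hx => ?_, hky, fun x hx hkx => ?_⟩
  · by_cases hx0 : x = 0
    · simp [hx0]
    · rw [kscale x hx hx0]
      have := hk2 _ (normalize x hx hx0)
      have h3 : 0 ≤ k ((h x)⁻¹ • x) := by nlinarith [sq_nonneg ‖q - (φ ((h x)⁻¹ • x) + t • v)‖]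
      exact mul_nonneg (hh x hx hx0).le h3
  · by_cases hx0 : x = 0
    · exact ⟨0, by simp [hx0]⟩
    · rw [kscale x hx hx0] at hkx
      have hz := (mul_eq_zero.1 hkx).resolve_left (hh x hx hx0).ne'
      have := hk2 _ (normalize x hx hx0)
      rw [hz, mul_zero] at this
      have h4 : q - (φ ((h x)⁻¹ • x) + t • v) = 0 := by
        rw [← norm_eq_zero, ← sq_eq_zero_iff]
        exact le_antisymm this (sq_nonneg _)
      have h5 : φ y = φ ((h x)⁻¹ • x) := by
        rw [hq, add_sub_add_right_eq_sub, sub_eq_zero] at h4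
        exact h4
      refine ⟨h x, ?_⟩
      rw [φ.injective h5, smul_inv_smul₀ (hh x hx hx0).ne']

/-- A point `p` of a cone that does not dominate some other point of the cone is contained in a
proper exposed face. -/
theorem exists_dual_eq_zero_of_not_dominating {C : PointedCone ℝ E}
    {p c : E} (hp : p ∈ C) (hc : c ∈ C) (hpc : ∀ t : ℝ, 0 < t → p - t • c ∉ C) :
    ∃ f : Dual ℝ E, (∀ x ∈ C, 0 ≤ f x) ∧ f p = 0 ∧ ∃ x ∈ C, f x ≠ 0 := by
  obtain ⟨s, hsC, hspan⟩ : ∃ s : Finset E, (s : Set E) ⊆ C ∧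
      Submodule.span ℝ (s : Set E) = Submodule.span ℝ (C : Set E) := by
    obtain ⟨b, hb, hspan, hli⟩ := exists_linearIndependent ℝ (C : Set E)
    have hfin : b.Finite := hli.set_finite_of_isNoetherian
    exact ⟨hfin.toFinset, by simpa using hb, by simpa using hspan⟩
  have he : ∑ x ∈ s, x ∈ C := C.sum_mem fun x hx => hsC hx
  -- A sum of spanning elements of C is an order unit of its span.
  set e := ∑ x ∈ s, x with hedef
  have hdom : ∀ v ∈ Submodule.span ℝ (C : Set E),
      ∃ t : ℝ, 0 ≤ t ∧ t • e + v ∈ C ∧ t • e - v ∈ C := by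
    intro v hv
    rw [← hspan] at hv
    induction hv using Submodule.span_induction with
    | mem x hx =>
      refine ⟨1, zero_le_one, by simpa using C.add_mem he (hsC hx), ?_⟩
      classical
      rw [one_smul, hedef, ← Finset.add_sum_erase s (fun x => x) (show x ∈ s from hx), add_sub_cancel_left]
      exact C.sum_mem fun z hz => hsC (Finset.mem_of_mem_erase hz)
    | zero => exact ⟨0, le_rfl, by simp⟩
    | add x y _ _ hx hy =>
      obtain ⟨t, ht, hx, hx'⟩ := hx
      obtain ⟨u, hu, hy, hy'⟩ := hy
      refine ⟨t + u, add_nonneg ht hu, ?_, ?_⟩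
      · convert! C.add_mem hx hy using 1
        module
      · convert! C.add_mem hx' hy' using 1
        module
    | smul a x _ hx =>
      obtain ⟨t, ht, hx, hx'⟩ := hx
      refine ⟨|a| * t, by positivity, ?_⟩
      rcases le_total 0 a with ha | ha
      · rw [abs_of_nonneg ha]
        constructor
        · convert! C.smul_mem ha hx using 1
          module
        · convert! C.smul_mem ha hx' using 1
          module
      · rw [abs_of_nonpos ha]
        constructor
        · convert! C.smul_mem (neg_nonneg.2 ha) hx' using 1
          module
        · convert! C.smul_mem (neg_nonneg.2 ha) hx using 1
          module
  have hCspan : ∀ x ∈ C, x ∈ Submodule.span ℝ (C : Set E) := fun x hx => Submodule.subset_span hx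
  -- C need not span E; the projection extends the order-unit property of e to all of E.
  obtain ⟨π, hπ⟩ : ∃ π : E →ₗ[ℝ] Submodule.span ℝ (C : Set E),
      π ∘ₗ (Submodule.span ℝ (C : Set E)).subtype = LinearMap.id :=
    LinearMap.exists_leftInverse_of_injective _ (Submodule.ker_subtype _)
  have hπ' : ∀ x ∈ C, (π x : E) = x := fun x hx => by
    have := LinearMap.congr_fun hπ ⟨x, hCspan x hx⟩
    exact congrArg Subtype.val this
  let D : PointedCone ℝ E :=
    { carrier := {v | ∃ u : ℝ, 0 ≤ u ∧ (π v : E) + u • p ∈ C}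
      zero_mem' := ⟨0, le_rfl, by simp⟩
      add_mem' := by
        rintro v w ⟨a, ha, hv⟩ ⟨b, hb, hw⟩
        refine ⟨a + b, add_nonneg ha hb, ?_⟩
        convert! C.add_mem hv hw using 1
        rw [map_add, Submodule.coe_add]
        module
      smul_mem' := by
        rintro ⟨r, hr⟩ v ⟨a, ha, hv⟩
        refine ⟨r * a, mul_nonneg hr ha, ?_⟩
        convert! C.smul_mem hr hv using 1
        rw [Nonneg.mk_smul, map_smul, Submodule.coe_smul]
        module }
  have hneg : ∀ a : ℝ, a < 0 → a • e ∉ D := by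
    rintro a ha ⟨u, hu, hmem⟩
    rw [map_smul, Submodule.coe_smul, hπ' e he] at hmem
    obtain ⟨t, ht, -, hct⟩ := hdom c (hCspan c hc)
    -- Since c ≤ t e ≤ (t + 1) e, the term a • e can be traded for a negative multiple of c. Adding
    -- p afterwards makes the coefficient of p positive even if u = 0.
    have h1 : u • p - (-a / (t + 1)) • c ∈ C := by
      have h2 := C.add_mem hmem (C.smul_mem (r := -a / (t + 1))
        (div_nonneg (by linarith) (by linarith)) (C.add_mem hct he))
      convert! h2 using 1
      have : a = -(-a / (t + 1)) * (t + 1) := by field_simp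
      nth_rw 2 [this]
      module
    have hκ : 0 < -a / (t + 1) := div_pos (by linarith) (by linarith)
    refine hpc (-a / (t + 1) / (u + 1)) (by positivity) ?_
    have h3 := C.smul_mem (inv_nonneg.2 (show 0 ≤ u + 1 by linarith)) (C.add_mem h1 hp)
    convert! h3 using 1
    rw [show u • p - (-a / (t + 1)) • c + p = (u + 1) • p - (-a / (t + 1)) • c by module,
      smul_sub, smul_smul, smul_smul, inv_mul_cancel₀ (by positivity), one_smul, div_eq_inv_mul]
  have he0 : e ≠ 0 := by
    intro he0
    obtain ⟨t, ht, h1, h2⟩ := hdom c (hCspan c hc)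
    rw [he0, smul_zero, zero_sub] at h2
    refine hpc 1 one_pos ?_
    rw [one_smul, sub_eq_add_neg]
    exact C.add_mem hp h2
  -- The functional a • e ↦ a extends positively to D. As D contains both C and -p, the extension is
  -- non-negative on C and vanishes at p.
  obtain ⟨f, hf, hfD⟩ := riesz_extension D (LinearPMap.mkSpanSingleton e (1 : ℝ) he0)
    (by
      rintro ⟨x, hx⟩ hxD
      obtain ⟨a, rfl⟩ := Submodule.mem_span_singleton.1 hx
      refine le_of_le_of_eq ?_ (LinearPMap.mkSpanSingleton'_apply e (1 : ℝ) _ a hx).symm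
      have : 0 ≤ a := not_lt.1 fun ha => hneg a ha hxD
      simpa using this)
    (by
      intro v
      obtain ⟨t, ht, h1, -⟩ := hdom (π v) (π v).2
      refine ⟨⟨t • e, Submodule.smul_mem _ _ (Submodule.mem_span_singleton_self e)⟩, 0, le_rfl, ?_⟩
      rw [zero_smul, add_zero, map_add, map_smul, Submodule.coe_add, Submodule.coe_smul, hπ' e he]
      exact h1)
  have hfC : ∀ x ∈ C, 0 ≤ f x := fun x hx =>
    hfD x ⟨0, le_rfl, by rw [hπ' x hx]; simpa using hx⟩
  have hfp : 0 ≤ f (-p) := hfD (-p) ⟨1, zero_le_one, by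
    rw [map_neg, Submodule.coe_neg, hπ' p hp]; simp⟩
  rw [map_neg] at hfp
  refine ⟨f, hfC, le_antisymm (by linarith) (hfC p hp), e, he, ?_⟩
  have := hf ⟨e, Submodule.mem_span_singleton_self e⟩
  rw [show f e = _ from this, LinearPMap.mkSpanSingleton_apply]
  exact one_ne_zero

end ConeGeometry

/-! ### Functionals whose product dominates a square. -/

section DominatingFunctionals

/-- Near the zeros of ψ the function φ is already positive; elsewhere ψ is bounded below, so a large
multiple outweighs φ. -/
theorem IsCompact.exists_forall_pos_add_mul {X : Type*} [TopologicalSpace X] {K : Set X}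
    (hK : IsCompact K) {φ ψ : X → ℝ} (hφ : ContinuousOn φ K) (hψ : ContinuousOn ψ K)
    (hψ0 : ∀ x ∈ K, 0 ≤ ψ x) (hpos : ∀ x ∈ K, ψ x = 0 → 0 < φ x) :
    ∃ N : ℝ, ∀ n, N ≤ n → ∀ x ∈ K, 0 < φ x + n * ψ x := by
  obtain ⟨t, ht0, ht⟩ : ∃ t : ℝ, 0 < t ∧ ∀ x ∈ K, t ≤ max (φ x) (ψ x) := by
    refine hK.exists_forall_le' (hφ.sup hψ) fun x hx => ?_
    rcases (hψ0 x hx).eq_or_lt with h | h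
    · exact lt_max_of_lt_left (hpos x hx h.symm)
    · exact lt_max_of_lt_right h
  obtain ⟨M, hM⟩ := hK.exists_bound_of_continuousOn hφ
  refine ⟨(|M| + 1) / t, fun n hn x hx => ?_⟩
  have hn0 : 0 ≤ n := le_trans (by positivity) hn
  rcases le_max_iff.1 (ht x hx) with h | h
  · exact add_pos_of_pos_of_nonneg (ht0.trans_le h) (mul_nonneg hn0 (hψ0 x hx))
  · have h1 : |M| + 1 ≤ n * ψ x :=
      calc |M| + 1 = (|M| + 1) / t * t := by field_simp
        _ ≤ n * ψ x := mul_le_mul hn h ht0.le hn0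
    have h2 := neg_le_of_abs_le (hM x hx)
    linarith [le_abs_self M]

variable {E : Type*} [NormedAddCommGroup E] [NormedSpace ℝ E] [FiniteDimensional ℝ E]

/-- On the base f₁ + f₂ = 1, large n settles all points where f₁ f₂ > 0. At f₁ = 0 one has 0 ≤ g ≤
r, hence g² ≤ r (g + τ); at f₂ = 0, g vanishes. That r does not depend on τ is what later permits τ
→ 0. -/
theorem exists_dominating_functionals {C : PointedCone ℝ E} (hC : IsClosed (C : Set E))
    {f₁ f₂ g : Dual ℝ E} (h₁ : ∀ x ∈ C, 0 ≤ f₁ x) (h₂ : ∀ x ∈ C, 0 ≤ f₂ x)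
    (hpos : ∀ x ∈ C, x ≠ 0 → 0 < f₁ x + f₂ x) (hg₁ : ∀ x ∈ C, f₁ x = 0 → 0 ≤ g x)
    (hg₂ : ∀ x ∈ C, f₂ x = 0 → g x = 0) :
    ∃ r : ℝ, 0 < r ∧ ∀ τ : ℝ, 0 < τ → ∃ n : ℝ, 1 ≤ n ∧ ∀ x ∈ C,
      0 ≤ r * (g x + τ * (f₁ x + f₂ x)) + n * f₁ x ∧
      g x ^ 2 ≤ (r * (g x + τ * (f₁ x + f₂ x)) + n * f₁ x) *
        (τ * (f₁ x + f₂ x) / n + f₂ x) := by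
  have c₁ := f₁.continuous_of_finiteDimensional
  have c₂ := f₂.continuous_of_finiteDimensional
  have cg := g.continuous_of_finiteDimensional
  have hK : IsCompact {x | x ∈ C ∧ (f₁ + f₂) x = 1} := isCompact_base hC hpos
  set K := {x | x ∈ C ∧ (f₁ + f₂) x = 1} with hKdef
  have hK1 : ∀ x ∈ K, f₂ x = 1 - f₁ x := fun x hx => by
    have : f₁ x + f₂ x = 1 := hx.2
    linarith
  obtain ⟨G, hG⟩ := hK.exists_bound_of_continuousOn cg.continuousOn
  refine ⟨|G| + 1, by positivity, fun τ hτ => ?_⟩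
  set r := |G| + 1 with hr
  have hr0 : 0 < r := by positivity
  have hgr : ∀ x ∈ K, g x ≤ r := fun x hx => by
    have := le_of_abs_le (hG x hx)
    linarith [le_abs_self G]
  obtain ⟨N₁, hN₁⟩ := hK.exists_forall_pos_add_mul (φ := fun x => r * (g x + τ))
    (ψ := fun x => f₁ x / 2) (by fun_prop) (by fun_prop)
    (fun x hx => by linarith [h₁ x hx.1]) (fun x hx h0 => by
      have := hg₁ x hx.1 (by linarith)
      positivity)
  obtain ⟨N₂, hN₂⟩ := hK.exists_forall_pos_add_mul
    (φ := fun x => r * (g x + τ) * (1 - f₁ x) - g x ^ 2 + f₁ x * τ / 2)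
    (ψ := fun x => f₁ x * (1 - f₁ x)) (by fun_prop) (by fun_prop)
    (fun x hx => mul_nonneg (h₁ x hx.1) (hK1 x hx ▸ h₂ x hx.1)) (fun x hx h0 => by
      rcases mul_eq_zero.1 h0 with h | h
      · have := hg₁ x hx.1 h
        simp only [h]
        nlinarith [hgr x hx, mul_pos hr0 hτ]
      · rw [hg₂ x hx.1 (by rw [hK1 x hx, h]), h, show f₁ x = 1 by linarith]
        linarith)
  set n := max 1 (max N₁ N₂) with hn
  have hn1 : 1 ≤ n := le_max_left _ _
  have hn0 : 0 < n := one_pos.trans_le hn1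
  have key : ∀ x ∈ K, 0 ≤ r * (g x + τ) + n * f₁ x ∧
      g x ^ 2 ≤ (r * (g x + τ) + n * f₁ x) * (τ / n + f₂ x) := by
    intro x hx
    have e₁ := hN₁ n ((le_max_left _ _).trans (le_max_right _ _)) x hx
    have e₂ := hN₂ n ((le_max_right _ _).trans (le_max_right _ _)) x hx
    have hf := h₁ x hx.1
    refine ⟨by nlinarith, ?_⟩
    have e₃ : 0 < τ / n * (r * (g x + τ) + n * (f₁ x / 2)) := mul_pos (div_pos hτ hn0) e₁
    -- The cross term τ f₁ is split in half: one half gives positivity at f₂ = 0, the other keeps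
    -- the remainder `e₃` positive.
    have e₄ : (r * (g x + τ) + n * f₁ x) * (τ / n + (1 - f₁ x)) - g x ^ 2 =
        (r * (g x + τ) * (1 - f₁ x) - g x ^ 2 + f₁ x * τ / 2 + n * (f₁ x * (1 - f₁ x))) +
          τ / n * (r * (g x + τ) + n * (f₁ x / 2)) := by
      field_simp
      ring
    rw [hK1 x hx]
    linarith
  refine ⟨n, hn1, fun x hx => ?_⟩
  by_cases hx0 : x = 0
  · simp [hx0]
  have hh := hpos x hx hx0
  set s := f₁ x + f₂ x with hs
  have hxK : s⁻¹ • x ∈ K := ⟨C.smul_mem (inv_pos.2 hh).le hx, by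
    rw [LinearMap.add_apply, map_smul, map_smul, smul_eq_mul, smul_eq_mul, ← mul_add, ← hs,
      inv_mul_cancel₀ hh.ne']⟩
  obtain ⟨k₁, k₂⟩ := key _ hxK
  simp only [map_smul, smul_eq_mul] at k₁ k₂
  constructor
  · have := mul_nonneg hh.le k₁
    convert! this using 1
    field_simp
  · have := mul_le_mul_of_nonneg_left k₂ (sq_nonneg s)
    convert! this using 1
    · field_simp
    · field_simp

end DominatingFunctionals

/-! ### Positive semidefinite matrices and their entries. -/

section HermitianMatrices

variable {n : ℕ}

/-- The rank-one hermitian matrix `v vᴴ`. -/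
def hermRankOne (v : Fin n → ℂ) : Herm n :=
  ⟨Matrix.vecMulVec v (star v), (Matrix.posSemidef_vecMulVec_self_star v).isHermitian⟩

theorem hermRankOne_mem_hermPos (v : Fin n → ℂ) : hermRankOne v ∈ hermPos n :=
  Matrix.posSemidef_vecMulVec_self_star v

/-- The real part of the `(i, j)` entry as a real functional on hermitian matrices. -/
def hermEntryRe (i j : Fin n) : Dual ℝ (Herm n) where
  toFun A := ((A : Matrix (Fin n) (Fin n) ℂ) i j).re
  map_add' A B := by simp
  map_smul' c A := by simp

theorem hermEntryRe_apply (i j : Fin n) (A : Herm n) :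
    hermEntryRe i j A = ((A : Matrix (Fin n) (Fin n) ℂ) i j).re := rfl

theorem hermEntryRe_diag_nonneg {A : Herm n} (hA : A ∈ hermPos n) (i : Fin n) :
    0 ≤ hermEntryRe i i A := by
  have h : (A : Matrix (Fin n) (Fin n) ℂ).PosSemidef := hA
  exact (Complex.le_def.1 (h.diag_nonneg (i := i))).1

theorem hermEntryRe_symm (i j : Fin n) (A : Herm n) : hermEntryRe i j A = hermEntryRe j i A := by
  have h : (A : Matrix (Fin n) (Fin n) ℂ).IsHermitian := A.2
  rw [hermEntryRe_apply, hermEntryRe_apply, ← h.apply i j]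
  simp

theorem hermEntryRe_sq_le {A : Herm n} (hA : A ∈ hermPos n) (i j : Fin n) :
    hermEntryRe i j A ^ 2 ≤ hermEntryRe i i A * hermEntryRe j j A := by
  have h : (A : Matrix (Fin n) (Fin n) ℂ).PosSemidef := hA
  have key : ∀ t : ℝ, 0 ≤ hermEntryRe i i A * (t * t) + 2 * hermEntryRe i j A * t +
      hermEntryRe j j A := by
    intro t
    have h1 := (Complex.le_def.1
      (h.dotProduct_mulVec_nonneg (Pi.single i (t : ℂ) + Pi.single j 1))).1
    rw [star_add, Matrix.mulVec_add, dotProduct_add, add_dotProduct, add_dotProduct,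
      Pi.star_single, Pi.star_single] at h1
    simp only [single_dotProduct, Matrix.mulVec_single] at h1
    simp at h1
    have h2 := hermEntryRe_symm i j A
    simp only [hermEntryRe_apply] at h2 ⊢
    rw [← h2] at h1
    linarith
  have := discrim_le_zero key
  rw [discrim] at this
  linarith

/-- The hermitian matrix with entries `1` at `(i, j)` and `(j, i)`. -/
def hermFlip (i j : Fin n) : Herm n :=
  hermRankOne (Pi.single i 1 + Pi.single j 1) - hermRankOne (Pi.single i 1) -
    hermRankOne (Pi.single j 1)

theorem hermRankOne_single_add_single (i j : Fin n) (a b : ℝ) :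
    hermRankOne (Pi.single i (a : ℂ) + Pi.single j (b : ℂ)) =
      a ^ 2 • hermRankOne (Pi.single i 1) + (a * b) • hermFlip i j +
        b ^ 2 • hermRankOne (Pi.single j 1) := by
  apply Subtype.ext
  ext k l
  simp only [hermFlip, hermRankOne, AddSubgroup.coe_add, AddSubgroup.coe_sub,
    selfAdjoint.val_smul, Matrix.add_apply, Matrix.sub_apply, Matrix.smul_apply,
    Matrix.vecMulVec_apply, Pi.add_apply, Pi.star_apply, Pi.single_apply, Complex.real_smul]
  split_ifs <;> simp <;> ring

theorem hermEntryRe_rankOne_single (i j k : Fin n) :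
    hermEntryRe i j (hermRankOne (Pi.single k 1)) = if i = k ∧ j = k then 1 else 0 := by
  simp only [hermEntryRe_apply, hermRankOne, Matrix.vecMulVec_apply, Pi.star_apply, Pi.single_apply]
  split_ifs <;> simp_all

theorem hermEntryRe_flip {i j : Fin n} (hij : i ≠ j) : hermEntryRe i j (hermFlip i j) = 1 := by
  rw [hermFlip, map_sub, map_sub, hermEntryRe_rankOne_single, hermEntryRe_rankOne_single]
  simp [hermEntryRe_apply, hermRankOne, Matrix.vecMulVec_apply, hij, hij.symm]

theorem hermEntryRe_flip_left {i j : Fin n} (hij : i ≠ j) :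
    hermEntryRe i i (hermFlip i j) = 0 := by
  rw [hermFlip, map_sub, map_sub, hermEntryRe_rankOne_single, hermEntryRe_rankOne_single]
  simp [hermEntryRe_apply, hermRankOne, Matrix.vecMulVec_apply, hij]

theorem hermEntryRe_flip_right {i j : Fin n} (hij : i ≠ j) :
    hermEntryRe j j (hermFlip i j) = 0 := by
  rw [hermFlip, map_sub, map_sub, hermEntryRe_rankOne_single, hermEntryRe_rankOne_single]
  simp [hermEntryRe_apply, hermRankOne, Matrix.vecMulVec_apply, hij.symm]

theorem mem_hermPos_of_forall_dual {A : Herm n}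
    (h : ∀ φ ∈ PointedCone.dual (Dual.eval ℝ (Herm n)) (hermPos n), 0 ≤ φ A) : A ∈ hermPos n := by
  have hA : (A : Matrix (Fin n) (Fin n) ℂ).IsHermitian := A.2
  refine Matrix.PosSemidef.of_dotProduct_mulVec_nonneg hA fun v => ?_
  let φ : Dual ℝ (Herm n) :=
    { toFun := fun B => (star v ⬝ᵥ (B : Matrix (Fin n) (Fin n) ℂ).mulVec v).re
      map_add' := fun B B' => by simp [Matrix.add_mulVec]
      map_smul' := fun c B => by simp [Matrix.smul_mulVec] }
  refine Complex.le_def.2 ⟨h φ fun B hB => ?_, ?_⟩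
  · have hB' : (B : Matrix (Fin n) (Fin n) ℂ).PosSemidef := hB
    exact (Complex.le_def.1 (hB'.dotProduct_mulVec_nonneg v)).1
  · exact (hA.im_star_dotProduct_mulVec_self v).symm

end HermitianMatrices

/-! ### Faces, test tensors and block functionals. -/

section OperatorSystemLevels

variable {E : Type*} [AddCommGroup E] [Module ℝ E] {n : ℕ}

theorem minOpSysLevel_induction {C : PointedCone ℝ E} {P : Herm n ⊗[ℝ] E → Prop}
    (tmul : ∀ A ∈ hermPos n, ∀ x ∈ C, P (A ⊗ₜ x)) (zero : P 0)
    (add : ∀ u ∈ minOpSysLevel n C, ∀ v ∈ minOpSysLevel n C, P u → P v → P (u + v))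
    (smul : ∀ (c : ℝ), 0 ≤ c → ∀ u ∈ minOpSysLevel n C, P u → P (c • u))
    {u : Herm n ⊗[ℝ] E} (hu : u ∈ minOpSysLevel n C) : P u := by
  refine Submodule.span_induction (p := fun u _ => P u) ?_ zero ?_ ?_ hu
  · rintro _ ⟨A, hA, x, hx, rfl⟩
    exact tmul A hA x hx
  · exact fun u v hu hv => add u hu v hv
  · exact fun c u hu => smul c c.2 u hu

theorem nonneg_of_mem_minOpSysLevel {C : PointedCone ℝ E} {W : Dual ℝ (Herm n ⊗[ℝ] E)}
    (hW : ∀ A ∈ hermPos n, ∀ x ∈ C, 0 ≤ W (A ⊗ₜ x)) {u : Herm n ⊗[ℝ] E}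
    (hu : u ∈ minOpSysLevel n C) : 0 ≤ W u := by
  refine minOpSysLevel_induction (P := fun u => 0 ≤ W u) hW (by simp) ?_ ?_ hu
  · intro u _ v _ h1 h2
    rw [map_add]
    exact add_nonneg h1 h2
  · intro c hc u _ h
    rw [map_smul]
    exact mul_nonneg hc h

/-- Equality of the minimal and maximal systems at a fixed level passes to exposed faces. -/
theorem minOpSysLevel_eq_max_face {C F : PointedCone ℝ E}
    (hP : minOpSysLevel n C = maxOpSysLevel n C) {f : Dual ℝ E} (hf : ∀ x ∈ C, 0 ≤ f x)
    (hF : ∀ x, x ∈ F ↔ x ∈ C ∧ f x = 0) : minOpSysLevel n F = maxOpSysLevel n F := by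
  refine le_antisymm (PointedCone.minTensorProduct_le_maxTensorProduct _ _) fun u hu => ?_
  have hFC : F ≤ C := fun x hx => ((hF x).1 hx).1
  have huC : u ∈ minOpSysLevel n C := by
    rw [hP]
    exact PointedCone.maxTensorProduct_mono le_rfl hFC hu
  let tr : Dual ℝ (Herm n) := ∑ i, hermEntryRe i i
  have htr : ∀ A ∈ hermPos n, 0 ≤ tr A := fun A hA => by
    simp only [tr, LinearMap.sum_apply]
    exact Finset.sum_nonneg fun i _ => hermEntryRe_diag_nonneg hA i
  have htr0 : ∀ A ∈ hermPos n, tr A = 0 → A = 0 := fun A hA h0 => by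
    simp only [tr, LinearMap.sum_apply] at h0
    have h : (A : Matrix (Fin n) (Fin n) ℂ).PosSemidef := hA
    apply Subtype.ext
    refine h.trace_eq_zero_iff.1 (Complex.ext ?_ ?_)
    · simpa [Matrix.trace, hermEntryRe_apply] using h0
    · exact ((Complex.le_def.1 h.trace_nonneg).2).symm
  let W : Dual ℝ (Herm n ⊗[ℝ] E) := dualDistrib ℝ _ _ (tr ⊗ₜ f)
  have hW : ∀ A ∈ hermPos n, ∀ x ∈ C, 0 ≤ W (A ⊗ₜ x) := fun A hA x hx =>
    mul_nonneg (htr A hA) (hf x hx)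
  have hW0 : W u = 0 := by
    -- Both f and -f are non-negative on F, which forces W u = 0. Each term A ⊗ x of a decomposition
    -- over C then has tr A = 0 or f x = 0.
    have hu' := PointedCone.mem_maxTensorProduct.1 hu
    refine le_antisymm ?_ (hu' tr (fun A hA => htr A hA) f fun x hx => hf x (hFC hx))
    have := hu' tr (fun A hA => htr A hA) (-f) fun x hx => by
      simp [((hF x).1 hx).2]
    rw [tmul_neg, map_neg (dualDistrib ℝ (Herm n) E), LinearMap.neg_apply] at this
    exact neg_nonneg.1 this
  refine minOpSysLevel_induction (P := fun u => W u = 0 → u ∈ minOpSysLevel n F)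
    ?_ ?_ ?_ ?_ huC hW0
  · intro A hA x hx h0
    rcases mul_eq_zero.1 (show tr A * f x = 0 from h0) with h | h
    · rw [htr0 A hA h, zero_tmul]
      exact zero_mem _
    · exact PointedCone.tmul_mem_minTensorProduct hA ((hF x).2 ⟨hx, h⟩)
  · exact fun _ => zero_mem _
  · intro u hu v hv h1 h2 h0
    have w1 := nonneg_of_mem_minOpSysLevel hW hu
    have w2 := nonneg_of_mem_minOpSysLevel hW hv
    rw [map_add] at h0
    exact add_mem (h1 (by linarith)) (h2 (by linarith))
  · intro c hc u hu h h0
    rw [map_smul, smul_eq_mul] at h0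
    rcases mul_eq_zero.1 h0 with h1 | h1
    · rw [h1, zero_smul]
      exact zero_mem _
    · exact PointedCone.smul_mem _ hc (h h1)

/-- The block tensor with diagonal entries `w₁ + ε² e`, `w₂ + ε² e` and off-diagonal entries `ε z`
lies in the maximal system as soon as `e ± z` lie in the cone, where `e = w₁ + w₂`. -/
theorem perturbed_block_mem_maxOpSysLevel {C : PointedCone ℝ E} (i j : Fin n) {w₁ w₂ z : E}
    (h₁ : w₁ ∈ C) (h₂ : w₂ ∈ C) (hz : w₁ + w₂ + z ∈ C) (hz' : w₁ + w₂ - z ∈ C) (ε : ℝ) :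
    hermRankOne (Pi.single i 1) ⊗ₜ (w₁ + ε ^ 2 • (w₁ + w₂)) +
      hermRankOne (Pi.single j 1) ⊗ₜ (w₂ + ε ^ 2 • (w₁ + w₂)) +
      hermFlip i j ⊗ₜ (ε • z) ∈ maxOpSysLevel n C := by
  refine PointedCone.mem_maxTensorProduct.2 fun φ hφ ψ hψ => ?_
  have q : ∀ a b : ℝ, 0 ≤ a ^ 2 * φ (hermRankOne (Pi.single i 1)) + a * b * φ (hermFlip i j) +
      b ^ 2 * φ (hermRankOne (Pi.single j 1)) := fun a b => by
    have := hφ (hermRankOne_mem_hermPos (Pi.single i (a : ℂ) + Pi.single j (b : ℂ)))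
    rw [hermRankOne_single_add_single] at this
    simpa using this
  have p₁ : 0 ≤ ψ w₁ := hψ h₁
  have p₂ : 0 ≤ ψ w₂ := hψ h₂
  have pz : 0 ≤ ψ (w₁ + w₂ + z) := hψ hz
  have pz' : 0 ≤ ψ (w₁ + w₂ - z) := hψ hz'
  simp only [map_add, map_sub] at pz pz'
  simp only [map_add, dualDistrib_apply, map_smul, smul_eq_mul]
  have a₁ := q 1 ε
  have a₂ := q 1 (-ε)
  have a₃ := q ε 1
  have a₄ := q ε (-1)
  have hs : 0 ≤ φ (hermRankOne (Pi.single i 1)) := hφ (hermRankOne_mem_hermPos _)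
  have ht : 0 ≤ φ (hermRankOne (Pi.single j 1)) := hφ (hermRankOne_mem_hermPos _)
  generalize φ (hermRankOne (Pi.single i 1)) = s at *
  generalize φ (hermRankOne (Pi.single j 1)) = t at *
  generalize φ (hermFlip i j) = m at *
  generalize ψ w₁ = x at *
  generalize ψ w₂ = y at *
  generalize ψ z = ζ at *
  have b₁ : 0 ≤ ε ^ 2 * (s * x) := by positivity
  have b₂ : 0 ≤ ε ^ 2 * (t * y) := by positivity
  -- Since |ζ| ≤ x + y, the off-diagonal term is at least -|ε m| (x + y), which `a₁`–`a₄` absorb.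
  rcases le_total 0 (ε * m) with h | h
  · nlinarith [mul_nonneg p₁ (show 0 ≤ s + ε ^ 2 * t - ε * m by linarith),
      mul_nonneg p₂ (show 0 ≤ t + ε ^ 2 * s - ε * m by linarith), mul_nonneg h pz]
  · nlinarith [mul_nonneg p₁ (show 0 ≤ s + ε ^ 2 * t + ε * m by linarith),
      mul_nonneg p₂ (show 0 ≤ t + ε ^ 2 * s + ε * m by linarith),
      mul_nonneg (neg_nonneg.2 h) pz']

/-- Evaluating the witness with diagonal `F₁`, `F₂` and off-diagonal `-g` on the perturbed blocks. -/
theorem sq_le_of_minOpSysLevel_eq_max {C : PointedCone ℝ E} (hn : 2 ≤ n)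
    (hP : minOpSysLevel n C = maxOpSysLevel n C) {F₁ F₂ g : Dual ℝ E}
    (hF₁ : ∀ x ∈ C, 0 ≤ F₁ x) (hF₂ : ∀ x ∈ C, 0 ≤ F₂ x) (hg : ∀ x ∈ C, g x ^ 2 ≤ F₁ x * F₂ x)
    {w₁ w₂ z : E} (h₁ : w₁ ∈ C) (h₂ : w₂ ∈ C) (hz : w₁ + w₂ + z ∈ C) (hz' : w₁ + w₂ - z ∈ C) :
    g z ^ 2 ≤ (F₁ w₁ + F₂ w₂) * (F₁ (w₁ + w₂) + F₂ (w₁ + w₂)) := by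
  let i : Fin n := ⟨0, by omega⟩
  let j : Fin n := ⟨1, by omega⟩
  have hij : i ≠ j := by simp [i, j]
  let W : Dual ℝ (Herm n ⊗[ℝ] E) := dualDistrib ℝ _ _
    (hermEntryRe i i ⊗ₜ F₁ + hermEntryRe j j ⊗ₜ F₂ - (2 : ℝ) • (hermEntryRe i j ⊗ₜ g))
  have hWt : ∀ A x, W (A ⊗ₜ x) = hermEntryRe i i A * F₁ x + hermEntryRe j j A * F₂ x -
      2 * (hermEntryRe i j A * g x) := fun A x => by
    simp [W]
  have hW : ∀ A ∈ hermPos n, ∀ x ∈ C, 0 ≤ W (A ⊗ₜ x) := by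
    intro A hA x hx
    rw [hWt]
    have a₁ := hermEntryRe_diag_nonneg hA i
    have a₂ := hermEntryRe_diag_nonneg hA j
    have a₃ := hermEntryRe_sq_le hA i j
    have b₁ := mul_nonneg a₁ (hF₁ x hx)
    have b₂ := mul_nonneg a₂ (hF₂ x hx)
    have b₃ : (2 * (hermEntryRe i j A * g x)) ^ 2 ≤
        (hermEntryRe i i A * F₁ x + hermEntryRe j j A * F₂ x) ^ 2 := by
      have := mul_le_mul a₃ (hg x hx) (sq_nonneg _) (mul_nonneg a₁ a₂)
      nlinarith [sq_nonneg (hermEntryRe i i A * F₁ x - hermEntryRe j j A * F₂ x)]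
    have := abs_le_of_sq_le_sq b₃ (add_nonneg b₁ b₂)
    linarith [le_of_abs_le this]
  -- Non-negativity for every ε is a discriminant condition.
  have key : ∀ ε : ℝ, 0 ≤ (F₁ (w₁ + w₂) + F₂ (w₁ + w₂)) * (ε * ε) + (-2 * g z) * ε +
      (F₁ w₁ + F₂ w₂) := by
    intro ε
    have hu := perturbed_block_mem_maxOpSysLevel i j h₁ h₂ hz hz' ε
    rw [← hP] at hu
    have := nonneg_of_mem_minOpSysLevel hW hu
    simp only [map_add W, hWt, hermEntryRe_flip hij, hermEntryRe_flip_left hij,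
      hermEntryRe_flip_right hij, hermEntryRe_rankOne_single, hij, hij.symm] at this
    simp at this
    simp only [map_add]
    linarith
  have := discrim_le_zero key
  rw [discrim] at this
  linarith

end OperatorSystemLevels

/-! ### The vanishing criterion. -/

section SimplicialityCriterion

variable {E : Type*} [NormedAddCommGroup E] [NormedSpace ℝ E] [FiniteDimensional ℝ E] {n : ℕ}

/-- If the minimal and maximal systems of `C` agree at some level `n ≥ 2`, then a functional that
vanishes at `w₁` and `w₂` (and is compatible with exposed faces containing them, which are disjoint
apart from `0`) vanishes on the order interval below `w₁ + w₂`. -/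
theorem eq_zero_of_minOpSysLevel_eq_max {C : PointedCone ℝ E} (hC : IsClosed (C : Set E))
    (hn : 2 ≤ n) (hP : minOpSysLevel n C = maxOpSysLevel n C)
    {f₁ f₂ g : Dual ℝ E} (h₁ : ∀ x ∈ C, 0 ≤ f₁ x) (h₂ : ∀ x ∈ C, 0 ≤ f₂ x)
    (hpos : ∀ x ∈ C, x ≠ 0 → 0 < f₁ x + f₂ x) (hg₁ : ∀ x ∈ C, f₁ x = 0 → 0 ≤ g x)
    (hg₂ : ∀ x ∈ C, f₂ x = 0 → g x = 0) {w₁ w₂ w : E} (hw₁ : w₁ ∈ C) (hw₂ : w₂ ∈ C)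
    (hw : w ∈ C) (hw' : w₁ + w₂ - w ∈ C) (hf₁ : f₁ w₁ = 0) (hf₂ : f₂ w₂ = 0) (hgw : g w₁ = 0) :
    g w = 0 := by
  obtain ⟨r, hr, H⟩ := exists_dominating_functionals hC h₁ h₂ hpos hg₁ hg₂
  have hgw₂ := hg₂ w₂ hw₂ hf₂
  set η := f₁ w₂ + f₂ w₁ with hη
  have hη0 : 0 ≤ η := add_nonneg (h₁ _ hw₂) (h₂ _ hw₁)
  have bound : ∀ τ : ℝ, 0 < τ → τ ≤ 1 →
      (2 * g w) ^ 2 ≤ τ * ((r + 1) * (r + 2) * η ^ 2) := by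
    intro τ hτ hτ1
    obtain ⟨m, hm, hm'⟩ := H τ hτ
    have hm0 : 0 < m := one_pos.trans_le hm
    set s := Real.sqrt m with hs
    have hs0 : 0 < s := Real.sqrt_pos.2 hm0
    have hsm : s ^ 2 = m := Real.sq_sqrt hm0.le
    -- Rescaling by s = √m keeps the product F₁ F₂ and balances the two: F₁ w₁ + F₂ w₂ is of order τ
    -- / s and F₁ + F₂ at w₁ + w₂ of order s, so m cancels from the bound.
    let F₁ : Dual ℝ E := s⁻¹ • (r • (g + τ • (f₁ + f₂)) + m • f₁)
    let F₂ : Dual ℝ E := s • ((τ / m) • (f₁ + f₂) + f₂)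
    have eF₁ : ∀ x, F₁ x = s⁻¹ * (r * (g x + τ * (f₁ x + f₂ x)) + m * f₁ x) := fun x => by
      simp [F₁]
      ring
    have eF₂ : ∀ x, F₂ x = s * (τ * (f₁ x + f₂ x) / m + f₂ x) := fun x => by
      simp [F₂]
      ring
    have key := sq_le_of_minOpSysLevel_eq_max hn hP (F₁ := F₁) (F₂ := F₂) (g := g)
      (fun x hx => by
        rw [eF₁]
        exact mul_nonneg (inv_pos.2 hs0).le (hm' x hx).1)
      (fun x hx => by
        rw [eF₂]
        have a₁ := h₁ x hx
        have a₂ := h₂ x hx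
        positivity)
      (fun x hx => by
        rw [eF₁, eF₂]
        refine (hm' x hx).2.trans_eq ?_
        field_simp)
      -- With this z, w₁ + w₂ ± z are 2w and 2(w₁ + w₂ - w), and g z = 2 g w.
      (z := (2 : ℝ) • w - (w₁ + w₂)) hw₁ hw₂
      (by
        convert! C.smul_mem (r := 2) (by norm_num) hw using 1
        module)
      (by
        convert! C.smul_mem (r := 2) (by norm_num) hw' using 1
        module)
    simp only [eF₁, eF₂, map_sub, map_add, map_smul, hgw, hgw₂, hf₁, hf₂, smul_eq_mul] at key
    have e₁ : (2 * g w) ^ 2 ≤ τ * ((r * f₂ w₁ + f₁ w₂) * η * (τ * (r + 1) / m + 1)) := by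
      convert! key using 1
      · ring
      · rw [← hsm, hη]
        field_simp
        ring
    refine e₁.trans (mul_le_mul_of_nonneg_left ?_ hτ.le)
    have b₁ := h₁ w₂ hw₂
    have b₂ := h₂ w₁ hw₁
    have c₁ : r * f₂ w₁ + f₁ w₂ ≤ (r + 1) * η := by
      rw [hη]
      nlinarith
    have c₂ : τ * (r + 1) / m + 1 ≤ r + 2 := by
      have : τ * (r + 1) / m ≤ r + 1 := by
        rw [div_le_iff₀ hm0]
        nlinarith
      linarith
    calc (r * f₂ w₁ + f₁ w₂) * η * (τ * (r + 1) / m + 1)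
        ≤ ((r + 1) * η) * η * (r + 2) := by gcongr
      _ = _ := by ring
  set K := (r + 1) * (r + 2) * η ^ 2 with hK
  have hK0 : 0 ≤ K := by positivity
  have hle : (2 * g w) ^ 2 ≤ 0 := by
    refine le_of_forall_pos_le_add fun δ hδ => ?_
    have := bound (min 1 (δ / (K + 1))) (by positivity) (min_le_left _ _)
    have h3 : min 1 (δ / (K + 1)) * K ≤ δ := by
      calc min 1 (δ / (K + 1)) * K ≤ δ / (K + 1) * (K + 1) :=
            mul_le_mul (min_le_right _ _) (by linarith) hK0 (by positivity)
        _ = δ := by field_simp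
    linarith
  nlinarith [sq_nonneg (g w)]

end SimplicialityCriterion

/-! ### Induction over a maximal exposed face, and the converse. -/

section Simpliciality

variable {E : Type*} [NormedAddCommGroup E] [NormedSpace ℝ E] [FiniteDimensional ℝ E] {n : ℕ}

omit [FiniteDimensional ℝ E] in
theorem nonneg_of_mem_hull {s : Set E} {g : Dual ℝ E} (hg : ∀ x ∈ s, 0 ≤ g x) {x : E}
    (hx : x ∈ PointedCone.hull ℝ s) : 0 ≤ g x := by
  induction hx using Submodule.span_induction with
  | mem x hx => exact hg x hx
  | zero => simp
  | add x y _ _ hx hy => rw [map_add]; exact add_nonneg hx hy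
  | smul c x _ hx =>
    rw [show c • x = (c : ℝ) • x from rfl, map_smul]
    exact mul_nonneg c.2 hx

/-- A functional that is nonzero on the cone and cuts out an exposed face of maximal dimension. -/
theorem exists_dual_maximal_face {C : PointedCone ℝ E} (hC : IsClosed (C : Set E))
    (hs : (C : ConvexCone ℝ E).Salient) {c : E} (hc : c ∈ C) (hc0 : c ≠ 0) :
    ∃ f : Dual ℝ E, (∀ x ∈ C, 0 ≤ f x) ∧ (∃ x ∈ C, f x ≠ 0) ∧
      ∀ k : Dual ℝ E, (∀ x ∈ C, 0 ≤ k x) → (∃ x ∈ C, k x ≠ 0) →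
        finrank ℝ (Submodule.span ℝ {x | x ∈ C ∧ k x = 0}) ≤
          finrank ℝ (Submodule.span ℝ {x | x ∈ C ∧ f x = 0}) := by
  obtain ⟨h, hh⟩ := exists_dual_strictly_pos hC hs
  let Q : Set (Dual ℝ E) := {f | (∀ x ∈ C, 0 ≤ f x) ∧ ∃ x ∈ C, f x ≠ 0}
  let μ : Dual ℝ E → ℕ := fun f => finrank ℝ (Submodule.span ℝ {x | x ∈ C ∧ f x = 0})
  have hfin : (μ '' Q).Finite := (Set.finite_Iic (finrank ℝ E)).subset (by
    rintro _ ⟨f, -, rfl⟩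
    exact Submodule.finrank_le _)
  have hQ : h ∈ Q := by
    refine ⟨fun x hx => ?_, c, hc, (hh c hc hc0).ne'⟩
    by_cases hx0 : x = 0
    · simp [hx0]
    · exact (hh x hx hx0).le
  obtain ⟨_, ⟨f, hf, rfl⟩, hmax⟩ := Set.exists_max_image (μ '' Q) id hfin ⟨_, h, hQ, rfl⟩
  exact ⟨f, hf.1, hf.2, fun k hk hk' => hmax _ ⟨k, ⟨hk, hk'⟩, rfl⟩⟩

/-- Combination of exposedness and the vanishing criterion: the point `w + y`, with `w` in an exposed
face and `y` on an exposed ray outside of it, is annihilated by a functional of the dual cone that is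
nonzero on `C`, provided some `g` vanishing at `w` and on the ray does not vanish at `c ∈ C`. -/
theorem exists_dual_eq_zero_of_minOpSysLevel_eq_max {C : PointedCone ℝ E}
    (hC : IsClosed (C : Set E)) (hn : 2 ≤ n) (hP : minOpSysLevel n C = maxOpSysLevel n C)
    {f k g : Dual ℝ E} (hf : ∀ x ∈ C, 0 ≤ f x) (hk : ∀ x ∈ C, 0 ≤ k x) {w y c : E} (hw : w ∈ C)
    (hy : y ∈ C) (hc : c ∈ C) (hfw : f w = 0) (hfy : 0 < f y) (hky : k y = 0)
    (hkray : ∀ x ∈ C, k x = 0 → ∃ t : ℝ, x = t • y) (hgf : ∀ x ∈ C, f x = 0 → 0 ≤ g x)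
    (hgw : g w = 0) (hgy : g y = 0) (hgc : g c ≠ 0) :
    ∃ φ : Dual ℝ E, (∀ x ∈ C, 0 ≤ φ x) ∧ φ w = 0 ∧ φ y = 0 ∧ ∃ x ∈ C, φ x ≠ 0 := by
  have hpos : ∀ x ∈ C, x ≠ 0 → 0 < f x + k x := by
    intro x hx hx0
    rcases (hk x hx).eq_or_lt with h | h
    · obtain ⟨t, rfl⟩ := hkray x hx h.symm
      have ht : t ≠ 0 := by
        rintro rfl
        simp at hx0
      have h1 := hf _ hx
      have h2 : f (t • y) ≠ 0 := by
        rw [map_smul, smul_eq_mul]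
        exact mul_ne_zero ht hfy.ne'
      rw [← h, add_zero]
      exact lt_of_le_of_ne h1 h2.symm
    · exact add_pos_of_nonneg_of_pos (hf x hx) h
  obtain ⟨φ, hφ, hφ0, hφ1⟩ := exists_dual_eq_zero_of_not_dominating (C.add_mem hw hy) hc
    (fun t ht hmem => by
      have := eq_zero_of_minOpSysLevel_eq_max hC hn hP hf hk hpos hgf
        (fun x hx hkx => by
          obtain ⟨t, rfl⟩ := hkray x hx hkx
          rw [map_smul, hgy, smul_zero])
        hw hy (C.smul_mem ht.le hc) hmem hfw hky hgw
      rw [map_smul, smul_eq_mul] at this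
      exact (mul_ne_zero ht.ne' hgc) this)
  rw [map_add] at hφ0
  have a₁ := hφ w hw
  have a₂ := hφ y hy
  exact ⟨φ, hφ, by linarith, by linarith, hφ1⟩

/-- A closed salient cone whose minimal and maximal systems agree at some level `n ≥ 2` is generated
by a linearly independent set. -/
theorem exists_linearIndepOn_hull_of_minOpSysLevel_eq_max (hn : 2 ≤ n) (C : PointedCone ℝ E)
    (hC : IsClosed (C : Set E)) (hs : (C : ConvexCone ℝ E).Salient)
    (hP : minOpSysLevel n C = maxOpSysLevel n C) :
    ∃ t : Finset E, LinearIndepOn ℝ id (t : Set E) ∧ C = PointedCone.hull ℝ (t : Set E) := by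
  classical
  induction hm : finrank ℝ (Submodule.span ℝ (C : Set E)) using Nat.strong_induction_on
    generalizing C with
  | _ m ih =>
  by_cases hbot : ∃ c ∈ C, c ≠ 0
  swap
  · push Not at hbot
    refine ⟨∅, by simp, ?_⟩
    refine le_antisymm (fun x hx => ?_) (Submodule.span_le.2 (by simp))
    rw [hbot x hx]
    exact zero_mem _
  obtain ⟨c₀, hc₀, hc₀0⟩ := hbot
  obtain ⟨f, hf, ⟨c, hc, hfc⟩, hmax⟩ := exists_dual_maximal_face hC hs hc₀ hc₀0
  let F : PointedCone ℝ E := C ⊓ PointedCone.ofSubmodule (LinearMap.ker f)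
  have hF : ∀ x, x ∈ F ↔ x ∈ C ∧ f x = 0 := fun x => Iff.rfl
  have hFset : (F : Set E) = {x | x ∈ C ∧ f x = 0} := rfl
  have hFclosed : IsClosed (F : Set E) := by
    rw [hFset]
    exact hC.inter (isClosed_eq f.continuous_of_finiteDimensional continuous_const)
  have hFs : (F : ConvexCone ℝ E).Salient := fun x hx hx0 hnx => hs x hx.1 hx0 hnx.1
  have hlt : finrank ℝ (Submodule.span ℝ (F : Set E)) < m := by
    rw [← hm]
    refine Submodule.finrank_lt_finrank_of_lt (lt_of_le_of_ne
      (Submodule.span_mono fun x hx => hx.1) fun heq => hfc ?_)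
    have h1 : Submodule.span ℝ (F : Set E) ≤ LinearMap.ker f :=
      Submodule.span_le.2 fun x hx => hx.2
    exact h1 (heq ▸ Submodule.subset_span hc)
  obtain ⟨t, htli, htF⟩ := ih _ hlt F hFclosed hFs (minOpSysLevel_eq_max_face hP hf hF) rfl
  have htFmem : ∀ b ∈ t, b ∈ F := fun b hb => htF ▸ Submodule.subset_span hb
  have htC : ∀ b ∈ t, b ∈ C := fun b hb => (htFmem b hb).1
  have htf : ∀ b ∈ t, f b = 0 := fun b hb => (htFmem b hb).2
  obtain ⟨y, hy, hfy, k, hk, hky, hkray⟩ :=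
    exists_exposed_ray_pos hC hs f hc (lt_of_le_of_ne (hf c hc) hfc.symm)
  have hspanF : Submodule.span ℝ (F : Set E) = Submodule.span ℝ (t : Set E) := by
    refine le_antisymm (Submodule.span_le.2 fun x hx => ?_)
      (Submodule.span_mono fun b hb => htFmem b hb)
    rw [htF] at hx
    exact PointedCone.hull_le_span ℝ _ hx
  have hyspan : y ∉ Submodule.span ℝ (t : Set E) := fun hmem => by
    have h1 : Submodule.span ℝ (t : Set E) ≤ LinearMap.ker f :=
      Submodule.span_le.2 fun x hx => htf x hx
    exact hfy.ne' (h1 hmem)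
  have hyt : y ∉ t := fun h => hyspan (Submodule.subset_span h)
  have hli : LinearIndepOn ℝ id (insert y (t : Set E)) := htli.id_insert hyspan
  have hwC : ∀ s : Finset E, s ⊆ t → ∑ b ∈ s, b ∈ C := fun s hst =>
    C.sum_mem fun b hb => htC b (hst hb)
  have hfw : ∀ s : Finset E, s ⊆ t → f (∑ b ∈ s, b) = 0 := fun s hst => by
    rw [map_sum]
    exact Finset.sum_eq_zero fun b hb => htf b (hst hb)
  have hzero : ∀ φ : Dual ℝ E, (∀ x ∈ C, 0 ≤ φ x) → ∀ s : Finset E, s ⊆ t →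
      φ (∑ b ∈ s, b) = 0 → ∀ b ∈ s, φ b = 0 := fun φ hφ s hst h0 => by
    rw [map_sum] at h0
    exact (Finset.sum_eq_zero_iff_of_nonneg fun b hb => hφ b (htC b (hst hb))).1 h0
  have hspan : ∀ x ∈ C, x ∈ Submodule.span ℝ (insert y (t : Set E)) := by
    intro x hx
    by_contra hxs
    obtain ⟨g, hgx, hg⟩ := Submodule.exists_le_ker_of_notMem hxs
    have hgt : ∀ b ∈ t, g b = 0 := fun b hb => hg (Submodule.subset_span (Or.inr hb))
    have hgy : g y = 0 := hg (Submodule.subset_span (Or.inl rfl))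
    obtain ⟨φ, hφ, hφw, hφy, hφ0⟩ := exists_dual_eq_zero_of_minOpSysLevel_eq_max hC hn hP hf hk
      (hwC t subset_rfl) hy hx (hfw t subset_rfl) hfy hky hkray
      (fun z hz hfz => nonneg_of_mem_hull (fun b hb => (hgt b hb).ge) (htF ▸ (hF z).2 ⟨hz, hfz⟩))
      (by rw [map_sum]; exact Finset.sum_eq_zero hgt) hgy hgx
    have hφt := hzero φ hφ t subset_rfl hφw
    -- The face cut out by φ contains t and y, so its span is strictly larger than that of F.
    refine (hmax φ hφ hφ0).not_gt (Submodule.finrank_lt_finrank_of_lt ?_)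
    rw [← hFset, hspanF]
    refine lt_of_le_of_ne (Submodule.span_mono fun b hb => ⟨htC b hb, hφt b hb⟩) fun heq => ?_
    exact hyspan (heq ▸ Submodule.subset_span ⟨hy, hφy⟩)
  have hcoord : ∀ a ∈ t, ∃ φ : Dual ℝ E, (∀ x ∈ C, 0 ≤ φ x) ∧ (∀ b ∈ t, b ≠ a → φ b = 0) ∧
      φ y = 0 ∧ 0 < φ a := by
    intro a ha
    have hays : a ∉ Submodule.span ℝ (insert y (t : Set E) \ {a}) := by
      have := linearIndepOn_iff_notMem_span.1 hli a (Or.inr ha)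
      simpa using this
    obtain ⟨g, hga, hg⟩ := Submodule.exists_le_ker_of_notMem hays
    have hgt : ∀ b ∈ t, b ≠ a → g b = 0 := fun b hb hba =>
      hg (Submodule.subset_span ⟨Or.inr hb, hba⟩)
    have hya : y ≠ a := fun h => hyt (h ▸ ha)
    have hgy : g y = 0 := hg (Submodule.subset_span ⟨Or.inl rfl, hya⟩)
    obtain ⟨φ, hφ, hφw, hφy, x, hx, hφx⟩ :=
      -- Normalizing g to 1 at a makes it non-negative on F, the cone generated by t.
      exists_dual_eq_zero_of_minOpSysLevel_eq_max (g := (g a)⁻¹ • g) hC hn hP hf hk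
        (hwC (t.erase a) (Finset.erase_subset _ _)) hy (htC a ha)
        (hfw (t.erase a) (Finset.erase_subset _ _)) hfy hky hkray
        (fun z hz hfz => nonneg_of_mem_hull (s := t) (fun b hb => by
          by_cases hba : b = a
          · subst hba
            simp [hga]
          · simp [hgt b hb hba]) (htF ▸ (hF z).2 ⟨hz, hfz⟩))
        (by
          rw [map_sum]
          refine Finset.sum_eq_zero fun b hb => ?_
          simp [hgt b (Finset.mem_of_mem_erase hb) (Finset.ne_of_mem_erase hb)])
        (by simp [hgy]) (by simp [hga])
    have hφt := hzero φ hφ _ (Finset.erase_subset _ _) hφw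
    refine ⟨φ, hφ, fun b hb hba => hφt b (Finset.mem_erase.2 ⟨hba, hb⟩), hφy,
      lt_of_le_of_ne (hφ a (htC a ha)) fun h0 => hφx ?_⟩
    have h1 : Submodule.span ℝ (insert y (t : Set E)) ≤ LinearMap.ker φ := by
      refine Submodule.span_le.2 ?_
      rintro b (rfl | hb)
      · exact hφy
      · by_cases hba : b = a
        · exact hba ▸ h0.symm
        · exact hφt b (Finset.mem_erase.2 ⟨hba, hb⟩)
    exact h1 (hspan x hx)
  refine ⟨insert y t, by rwa [Finset.coe_insert], le_antisymm (fun x hx => ?_) ?_⟩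
  · have hxs := hspan x hx
    rw [← Finset.coe_insert, Submodule.mem_span_finset] at hxs
    obtain ⟨a, -, rfl⟩ := hxs
    rw [Finset.sum_insert hyt] at hx ⊢
    refine add_mem (PointedCone.smul_mem _ ?_ (Submodule.subset_span (by simp)))
      (sum_mem fun b hb => PointedCone.smul_mem _ ?_ (Submodule.subset_span (by simp [hb])))
    -- f vanishes on t and is positive at y, so it detects the sign of the coefficient of y.
    · have h1 := hf _ hx
      rw [map_add, map_sum, Finset.sum_eq_zero fun b hb => by rw [map_smul, htf b hb, smul_zero],
        add_zero, map_smul, smul_eq_mul] at h1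
      exact nonneg_of_mul_nonneg_left h1 hfy
    · obtain ⟨φ, hφ, hφt, hφy, hφb⟩ := hcoord b hb
      have h1 := hφ _ hx
      rw [map_add, map_smul, hφy, smul_zero, zero_add, map_sum, Finset.sum_eq_single b
        (fun b' hb' hne => by rw [map_smul, hφt b' hb' hne, smul_zero])
        (fun h => absurd hb h), map_smul, smul_eq_mul] at h1
      exact nonneg_of_mul_nonneg_left h1 hφb
  · refine Submodule.span_le.2 fun b hb => ?_
    rcases Finset.mem_insert.1 hb with rfl | hb
    · exact hy
    · exact htC b hb

theorem isSimplexCone_of_minOpSysLevel_eq_max (hn : 2 ≤ n) {C : PointedCone ℝ E}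
    (hC : IsClosed (C : Set E)) (hs : (C : ConvexCone ℝ E).Salient)
    (hg : (C : ConvexCone ℝ E).IsReproducing)
    (hP : minOpSysLevel n C = maxOpSysLevel n C) : IsSimplexCone C := by
  obtain ⟨t, hli, rfl⟩ := exists_linearIndepOn_hull_of_minOpSysLevel_eq_max hn C hC hs hP
  have htop : Submodule.span ℝ (t : Set E) = ⊤ := by
    rw [eq_top_iff, ← hg.span_eq_top]
    exact Submodule.span_le.2 fun x hx => PointedCone.hull_le_span ℝ _ hx
  let b : Basis t ℝ E := Basis.mk (v := ((↑) : t → E)) hli (by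
    rw [Subtype.range_coe_subtype]
    exact htop.ge)
  have hcard : Fintype.card t = finrank ℝ E := (finrank_eq_card_basis b).symm
  refine ⟨b.reindex (Fintype.equivFinOfCardEq hcard), ?_⟩
  rw [Basis.range_reindex, show ⇑b = ((↑) : t → E) from Basis.coe_mk _ _,
    Subtype.range_coe_subtype]
  rfl

-- The coordinate functionals of the generating basis are non-negative on C, so testing u against φ
-- ⊗ coordinate shows that each matrix coefficient of u in this basis is positive semidefinite.
omit [FiniteDimensional ℝ E] in
theorem IsSimplexCone.minOpSysLevel_eq_max {C : PointedCone ℝ E} (hC : IsSimplexCone C) (n : ℕ) :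
    minOpSysLevel n C = maxOpSysLevel n C := by
  obtain ⟨b, rfl⟩ := hC
  refine le_antisymm (PointedCone.minTensorProduct_le_maxTensorProduct _ _) fun u hu => ?_
  let T : Fin (finrank ℝ E) → Herm n ⊗[ℝ] E →ₗ[ℝ] Herm n := fun i =>
    (TensorProduct.rid ℝ (Herm n)).toLinearMap ∘ₗ (b.coord i).lTensor (Herm n)
  have hT : ∀ i (φ : Dual ℝ (Herm n)), φ ∘ₗ T i = dualDistrib ℝ _ _ (φ ⊗ₜ b.coord i) := by
    intro i φ
    refine TensorProduct.ext' fun A x => ?_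
    simp [T, mul_comm]
  have hsum : ∀ u, u = ∑ i, T i u ⊗ₜ[ℝ] b i := by
    intro u
    induction u with
    | zero => simp
    | tmul A x =>
      simp only [T, LinearMap.comp_apply, LinearMap.lTensor_tmul, LinearEquiv.coe_coe,
        TensorProduct.rid_tmul, smul_tmul]
      rw [← tmul_sum]
      simp [b.sum_repr x]
    | add u v hu hv =>
      simp only [map_add, add_tmul, Finset.sum_add_distrib]
      rw [← hu, ← hv]
  rw [hsum u]
  refine sum_mem fun i _ => PointedCone.tmul_mem_minTensorProduct
    (mem_hermPos_of_forall_dual fun φ hφ => ?_) (Submodule.subset_span ⟨i, rfl⟩)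
  have := PointedCone.mem_maxTensorProduct.1 hu φ hφ (b.coord i) fun x hx =>
    nonneg_of_mem_hull (g := b.coord i) (by
      rintro _ ⟨j, rfl⟩
      rw [Basis.coord_apply, Basis.repr_self, Finsupp.single_apply]
      split_ifs <;> simp) hx
  rw [← hT] at this
  exact this

end Simpliciality

end

theorem corollaryG (d : ℕ) (C : PointedCone ℝ (Fin d → ℝ))
    (hclosed : IsClosed (C : Set (Fin d → ℝ)))
    (hproper : (C : ConvexCone ℝ (Fin d → ℝ)).Salient)
    (hgenerating : (C : ConvexCone ℝ (Fin d → ℝ)).IsReproducing)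
    (hC : d ≤ 4 ∨ IsStrictlyConvexCone C ∨ IsSmoothCone C ∨ IsPolyhedralCone C) :
    List.TFAE [
      IsSimplexCone C,
      minOpSys C = maxOpSys C,
      ∃ n : ℕ, 2 ≤ n ∧ minOpSysLevel n C = maxOpSysLevel n C,
      minOpSysLevel 2 C = maxOpSysLevel 2 C] := by
  tfae_have 1 → 2 := fun h => funext fun n => h.minOpSysLevel_eq_max n
  tfae_have 2 → 4 := fun h => congrFun h 2
  tfae_have 4 → 3 := fun h => ⟨2, le_rfl, h⟩
  tfae_have 3 → 1 := fun ⟨_, hn, h⟩ =>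
    isSimplexCone_of_minOpSysLevel_eq_max hn hclosed hproper hgenerating h
  tfae_finish
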